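/- Setting (the Fitzsimons–Kashefi (FK) protocol). Let $\widetilde K_{3N}$ be the dotted-complete graph: the complete graph on $3N$ (primary) vertices in which every edge is replaced by a new (dotted) vertex joined to the two endpoints of that edge. Its vertices label the qubits. The verifier splits the primary vertices, by a uniformly random hidden partition, into three labelled groups of $N$. Group $0$, together with the dotted vertices on those of its pairs that are edges of the computation graph $\mathcal G$, carries an arbitrary adaptive measurement-based computation; the primary vertices of group $1$ and the dotted vertices joining two vertices of group $2$ are traps; all other vertices are dummies. The verifier sends the ideal input $\Psi^\nu=\bigotimes_w \pi_w$, where $\nu$ denotes all his secret uniformly random choices: $\pi_w=|d_w\rangle\langle d_w|$, $d_w\in\{0,1\}$, for dummies, and $\pi_w=|+_{\theta_w}\rangle\langle +_{\theta_w}|$, $\theta_w\in\{0,\pi/4,\dots,7\pi/4\}$, otherwise. The prover applies controlled-$Z$ along all edges of $\widetilde K_{3N}$ and measures each qubit $w$ in the basis $|\pm_{\delta_w}\rangle$, where $\delta_w=\theta_w+\phi'_w+r_w\pi$ is sent by the verifier, $r_w\in\{0,1\}$ is random, and the adapted angle $\phi'_w$ includes the $Z$-correction $\pi\cdot\#\{\text{dummy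 neighbours } u \text{ of } w \text{ with } d_u=1\}$; traps have computation angle $a_t\pi$ with $a_t\in\{0,1\}$ random. The verifier accepts iff every trap $t$ gives its expected outcome $b_t=r_t\oplus a_t$. Let $\mathcal R\Psi^\nu=\bigotimes_w R(\pi_w)$ be the reflection of the ideal input about the $XY$-plane, where $R$ maps the qubit state with Bloch vector $(x,y,z)$ to the one with Bloch vector $(x,y,-z)$ (so exactly the dummies are flipped). Lemma. There is an absolute constant $K>0$ such that the following holds for every $N$ and every computation. Assume that, for every partition, some trap has an odd number of dummy neighbours, and that the prover carries out the steps above. Then on the input $\mathcal R\Psi^\nu$ the verifier rejects with probability $1$, for every $\nu$. Moreover, if for every $\nu$ the input is a density operator $\rho^\nu$ on the same qubits with $\tfrac12\|\rho^\nu-\mathcal R\Psi^\nu\|_1\le\varepsilon$, then the verifier rejects with probability at least $1-K\sqrt{\varepsilon}$, both for every fixed $\nu$ and on average over $\nu$. -/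

import Mathlib

open scoped ComplexOrder

noncomputable section

namespace FK

/-! ### Dotted graphs -/

/-- Vertices of the dotted graph of `G`: the vertices of `G` (primary vertices), and one new
(dotted) vertex for every edge of `G`. -/
abbrev DottedVertex {W : Type} (G : SimpleGraph W) : Type := W ⊕ G.edgeSet

/-- The dotted graph of `G`: every edge of `G` is replaced by a new vertex joined to the two
endpoints of that edge. -/
def dotted {W : Type} (G : SimpleGraph W) : SimpleGraph (DottedVertex G) where
  Adj
    | Sum.inl v, Sum.inr e => v ∈ e.1
    | Sum.inr e, Sum.inl v => v ∈ e.1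
    | _, _ => False
  symm := ⟨by rintro (v | e) (w | f) h <;> exact h⟩
  loopless := ⟨by rintro (v | e) h <;> exact h⟩

/-- Vertices of the dotted-complete graph on `3N` primary vertices; the qubits of the protocol are
indexed by this type. -/
abbrev Qubit (N : ℕ) : Type := DottedVertex (⊤ : SimpleGraph (Fin (3 * N)))

/-! ### Qubits, states and distances -/

/-- Operators on the qubits labelled by `V`, in the computational basis. -/
abbrev Op (V : Type) : Type := Matrix (V → Fin 2) (V → Fin 2) ℂ

/-- Tensor product of single-qubit operators. -/
def tensor {V : Type} [Fintype V] (A : V → Matrix (Fin 2) (Fin 2) ℂ) : Op V :=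
  Matrix.of fun x y => ∏ v, A v (x v) (y v)

/-- `|ψ⟩⟨ψ|`. -/
def proj (ψ : Fin 2 → ℂ) : Matrix (Fin 2) (Fin 2) ℂ := Matrix.vecMulVec ψ (star ψ)

/-- `|+_θ⟩ = (|0⟩ + e^{iθ}|1⟩)/√2`. Angles are the multiples of `π/4`: the element `θ` of `ZMod 8`
stands for the angle `θ * π / 4`. -/
def plusKet (θ : ZMod 8) : Fin 2 → ℂ :=
  ![1 / (Real.sqrt 2 : ℂ),
    Complex.exp (Complex.I * ((θ.val : ℂ) * (Real.pi : ℂ) / 4)) / (Real.sqrt 2 : ℂ)]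

/-- The computational basis state `|d⟩`. -/
def basisKet (d : Fin 2) : Fin 2 → ℂ := Pi.single d 1

/-- The angle `b * π`. -/
def piTimes (b : Fin 2) : ZMod 8 := 4 * (b.val : ZMod 8)

def pauliX : Matrix (Fin 2) (Fin 2) ℂ := !![0, 1; 1, 0]
def pauliY : Matrix (Fin 2) (Fin 2) ℂ := !![0, -Complex.I; Complex.I, 0]
def pauliZ : Matrix (Fin 2) (Fin 2) ℂ := !![1, 0; 0, -1]

/-- Reflection of a one-qubit state about the `XY`-plane of the Bloch ball: the Bloch vector
`(x, y, z)` becomes `(x, y, -z)`. -/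
def reflectXY (A : Matrix (Fin 2) (Fin 2) ℂ) : Matrix (Fin 2) (Fin 2) ℂ :=
  (1 / 2 : ℂ) • (A.trace • (1 : Matrix (Fin 2) (Fin 2) ℂ) + (pauliX * A).trace • pauliX
    + (pauliY * A).trace • pauliY - (pauliZ * A).trace • pauliZ)

/-- Density operators. -/
def IsDensity {V : Type} [Fintype V] [DecidableEq V] (ρ : Op V) : Prop := ρ.PosSemidef ∧ ρ.trace = 1

/-- The trace norm: the sum of the singular values. -/
def traceNorm {n : Type} [Fintype n] [DecidableEq n] (A : Matrix n n ℂ) : ℝ :=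
  ∑ i, Real.sqrt ((Matrix.isHermitian_conjTranspose_mul_self A).eigenvalues i)

/-- The trace distance. -/
def traceDist {n : Type} [Fintype n] [DecidableEq n] (A B : Matrix n n ℂ) : ℝ :=
  traceNorm (A - B) / 2

open Classical in
/-- The product of the controlled-`Z` gates over all edges of a graph. -/
def entangle {V : Type} [Fintype V] (G : SimpleGraph V) : Op V :=
  Matrix.diagonal fun x => ∏ e ∈ G.edgeFinset, if ∀ v ∈ e, x v = 1 then (-1 : ℂ) else 1

/-! ### The protocol -/

/-- A delegated measurement-based computation: an (encoded) graph on `N` vertices whose dotted graph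
carries the computation, the computation angles, the order in which the computation qubits are
measured, and the rules for the `X`- and `Z`-corrections of a measurement, which depend on the
(decoded) outcomes of earlier measurements only. -/
structure Computation (N : ℕ) where
  graph : SimpleGraph (Fin N)
  angle : DottedVertex graph → ZMod 8
  step : DottedVertex graph → ℕ
  xCorr : DottedVertex graph → (DottedVertex graph → Fin 2) → Fin 2
  zCorr : DottedVertex graph → (DottedVertex graph → Fin 2) → Fin 2
  xCorr_causal : ∀ i s s', (∀ j, step j < step i → s j = s' j) → xCorr i s = xCorr i s'
  zCorr_causal : ∀ i s s', (∀ j, step j < step i → s j = s' j) → zCorr i s = zCorr i s'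

/-- The hidden partition of the primary vertices into three groups of `N`: group `0` carries the
computation, group `1` the traps on primary vertices, group `2` surrounds the traps on dotted
vertices. -/
abbrev Layout (N : ℕ) : Type := Fin (3 * N) ≃ Fin 3 × Fin N

/-- The verifier's secret random choices: the layout, the rotations `θ`, the bits `r` hiding the
outcomes, the values `d` of the dummies, and the trap angles `a * π`. (Only the entries of `d` at
dummies and of `a` at traps are used.) -/
structure Secret (N : ℕ) where
  layout : Layout N
  θ : Qubit N → ZMod 8
  r : Qubit N → Fin 2
  d : Qubit N → Fin 2
  a : Qubit N → Fin 2

instance (N : ℕ) : Fintype (Secret N) :=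
  Fintype.ofEquiv
    (Layout N × (Qubit N → ZMod 8) × (Qubit N → Fin 2) × (Qubit N → Fin 2) × (Qubit N → Fin 2))
    { toFun := fun p => ⟨p.1, p.2.1, p.2.2.1, p.2.2.2.1, p.2.2.2.2⟩
      invFun := fun ν => (ν.layout, ν.θ, ν.r, ν.d, ν.a)
      left_inv := fun _ => rfl
      right_inv := fun _ => rfl }

variable {N : ℕ}

/-- The computation graph sits on group `0`. -/
def graphHom (C : Computation N) (σ : Layout N) :
    C.graph →g (⊤ : SimpleGraph (Fin (3 * N))) where
  toFun i := σ.symm (0, i)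
  map_rel' {i j} h := by
    rw [SimpleGraph.top_adj]
    intro h'
    exact h.ne (Prod.ext_iff.1 (σ.symm.injective h')).2

/-- The position of a computation qubit among all qubits. -/
def place (C : Computation N) (σ : Layout N) : DottedVertex C.graph → Qubit N :=
  Sum.map (graphHom C σ) (graphHom C σ).mapEdgeSet

def IsComputation (C : Computation N) (σ : Layout N) (w : Qubit N) : Prop :=
  ∃ c, place C σ c = w

/-- Traps: the primary vertices of group `1`, and the dotted vertices inside group `2`. -/
def IsTrap (σ : Layout N) : Qubit N → Prop
  | Sum.inl v => (σ v).1 = 1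
  | Sum.inr e => ∀ v ∈ e.1, (σ v).1 = 2

/-- All other qubits are dummies. -/
def IsDummy (C : Computation N) (σ : Layout N) (w : Qubit N) : Prop :=
  ¬ IsComputation C σ w ∧ ¬ IsTrap σ w

/-- The dummy neighbours of a qubit in the dotted-complete graph. -/
def dummyNeighbors (C : Computation N) (σ : Layout N) (w : Qubit N) : Set (Qubit N) :=
  {u | (dotted (⊤ : SimpleGraph (Fin (3 * N)))).Adj w u ∧ IsDummy C σ u}

/-- Some trap has an odd number of dummy neighbours. -/
def HasOddTrap (C : Computation N) (σ : Layout N) : Prop :=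
  ∃ t, IsTrap σ t ∧ Odd (dummyNeighbors C σ t).ncard

open Classical in
/-- The pure state of each qubit that the verifier intends to send: `|d⟩` for dummies, `|+_θ⟩` for
computation and trap qubits. -/
def idealKet (C : Computation N) (ν : Secret N) (w : Qubit N) : Fin 2 → ℂ :=
  if IsDummy C ν.layout w then basisKet (ν.d w) else plusKet (ν.θ w)

/-- The ideal input state. -/
def idealInput (C : Computation N) (ν : Secret N) : Op (Qubit N) :=
  tensor fun w => proj (idealKet C ν w)

/-- The reflection of the ideal input about the `XY`-plane. -/
def reflectedInput (C : Computation N) (ν : Secret N) : Op (Qubit N) :=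
  tensor fun w => reflectXY (proj (idealKet C ν w))

/-- The angle of a computation qubit, adapted to the decoded outcomes `s` of the computation
qubits: `(-1)^{s_X} φ + s_Z π`. -/
def adaptedAngle (C : Computation N) (s : DottedVertex C.graph → Fin 2)
    (i : DottedVertex C.graph) : ZMod 8 :=
  (if C.xCorr i s = 1 then - C.angle i else C.angle i) + piTimes (C.zCorr i s)

open Classical in
/-- The adapted angle `φ'` of a qubit, before accounting for dummy neighbours, when `b` is the list
of reported outcomes: the adapted computation angle for computation qubits, `0` or `π` for traps,
`0` for dummies. The outcome `b` of a qubit is decoded to `b + r`. -/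
def baseAngle (C : Computation N) (ν : Secret N) (b : Qubit N → Fin 2) : Qubit N → ZMod 8 :=
  Function.extend (place C ν.layout)
    (adaptedAngle C fun c => b (place C ν.layout c) + ν.r (place C ν.layout c))
    (fun w => if IsTrap ν.layout w then piTimes (ν.a w) else 0)

/-- The number of neighbours of a qubit which the verifier meant to be dummies in state `|1⟩`; each
of them makes the verifier expect a `Z` on that qubit. -/
def oneNeighbors (C : Computation N) (ν : Secret N) (w : Qubit N) : ℕ :=
  {u ∈ dummyNeighbors C ν.layout w | ν.d u = 1}.ncard

/-- The measurement angle `δ = θ + φ' + r π` which the verifier sends. -/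
def measAngle (C : Computation N) (ν : Secret N) (b : Qubit N → Fin 2) (w : Qubit N) : ZMod 8 :=
  ν.θ w + (baseAngle C ν b w + 4 * (oneNeighbors C ν w : ZMod 8)) + piTimes (ν.r w)

/-- The probability that the outcomes `b` are reported when the prover receives the state `ρ` and
follows the protocol: he applies the controlled-`Z` gates of the dotted-complete graph and measures
each qubit `w` in the basis `|+_δ⟩` (outcome `0`), `|-_δ⟩ = |+_{δ+π}⟩` (outcome `1`), with the
adaptive angles `δ` sent by the verifier. -/
def outcomeProb (C : Computation N) (ν : Secret N) (ρ : Op (Qubit N)) (b : Qubit N → Fin 2) : ℝ :=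
  let E : Op (Qubit N) := entangle (dotted (⊤ : SimpleGraph (Fin (3 * N))))
  (((tensor fun w => proj (plusKet (measAngle C ν b w + piTimes (b w))))
    * (E * ρ * E.conjTranspose)).trace).re

/-- The verifier accepts if every trap gives its expected outcome. -/
def Accepts (ν : Secret N) (b : Qubit N → Fin 2) : Prop :=
  ∀ t, IsTrap ν.layout t → b t = ν.r t + ν.a t

open Classical in
/-- The probability that the verifier rejects, for given secret choices. -/
def rejectProb (C : Computation N) (ν : Secret N) (ρ : Op (Qubit N)) : ℝ :=
  ∑ b : Qubit N → Fin 2, if Accepts ν b then 0 else outcomeProb C ν ρ b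

/-- The probability that the protocol rejects: the secret choices are uniformly random, and `ρ ν` is
the input state sent for the choices `ν`. -/
def protocolRejectProb (C : Computation N) (ρ : Secret N → Op (Qubit N)) : ℝ :=
  (∑ ν, rejectProb C ν (ρ ν)) / (Fintype.card (Secret N) : ℝ)

end FK

end

noncomputable section

namespace FK

/-! ### The trace norm bounds the distinguishability -/

section TraceNorm

variable {n : Type} [Fintype n] [DecidableEq n]

/-! Every neighbour of a trap is a dummy (`isDummy_of_adj_isTrap`), so on the ideal input a trap
would give its expected outcome with certainty: the `Z`s produced by dummies in state `|1⟩` are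
exactly those the verifier corrects for. The reflection fixes the equatorial states and flips every
dummy, so a trap with `m` dummy neighbours picks up `m` unwanted `Z`s, modulo 2. For odd `m` its
outcome is certainly wrong. Concretely, if `b` is accepted, the terms of its amplitude cancel in
pairs `x`, `x` flipped at `t` (`amplitudeTerm_update`).

For rejection probability 1 the outcome probabilities must also sum to 1, although the angles are
adaptive. By causality the product kets of distinct outcome strings are orthogonal
(`exists_measAngle_eq_of_ne`), so the whole run is one unitary followed by a computational-basis
measurement.

Rejection is thus the expectation of a projection, and its change under a perturbation of the input
is bounded by the trace norm. This gives the linear bound `1 - 2ε`, which is stronger than the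
stated one when `ε ≤ 1`. -/

theorem norm_toEuclideanLin_eigenvectorBasis (A : Matrix n n ℂ) (i : n) :
    ‖Matrix.toEuclideanLin A
        ((Matrix.isHermitian_conjTranspose_mul_self A).eigenvectorBasis i)‖ =
      Real.sqrt ((Matrix.isHermitian_conjTranspose_mul_self A).eigenvalues i) := by
  set H := Matrix.isHermitian_conjTranspose_mul_self A with hH
  set v := H.eigenvectorBasis i with hv
  have h1 : inner ℂ (Matrix.toEuclideanLin A v) (Matrix.toEuclideanLin A v)
      = (H.eigenvalues i : ℂ) := by
    rw [← LinearMap.adjoint_inner_right, ← Matrix.toEuclideanLin_conjTranspose_eq_adjoint]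
    have h2 : Matrix.toEuclideanLin A.conjTranspose (Matrix.toEuclideanLin A v)
        = (H.eigenvalues i : ℂ) • v := by
      have h3 := H.mulVec_eigenvectorBasis i
      rw [← Matrix.mulVec_mulVec] at h3
      ext k
      exact congrFun h3 k
    rw [h2, inner_smul_right, inner_self_eq_norm_sq_to_K, H.eigenvectorBasis.orthonormal.1 i]
    simp
  rw [inner_self_eq_norm_sq_to_K] at h1
  have h4 : ‖Matrix.toEuclideanLin A v‖ ^ 2 = H.eigenvalues i := by
    apply Complex.ofReal_injective
    rw [Complex.ofReal_pow]
    exact h1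
  rw [← h4, Real.sqrt_sq (norm_nonneg _)]

/-- Expand the trace in the eigenbasis of `AᴴA`. By Cauchy–Schwarz and `‖M‖ ≤ 1` the `i`-th term is
at most `‖A vᵢ‖`, which is the `i`-th singular value. -/
theorem norm_trace_mul_le_traceNorm (M A : Matrix n n ℂ) (hM : IsStarProjection M) :
    ‖(M * A).trace‖ ≤ traceNorm A := by
  set H := Matrix.isHermitian_conjTranspose_mul_self A
  have hM' : ‖Matrix.toEuclideanCLM (n := n) (𝕜 := ℂ) M‖ ≤ 1 :=
    IsStarProjection.norm_le _ (hM.map (Matrix.toEuclideanCLM (n := n) (𝕜 := ℂ)))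
  have htr : (M * A).trace = ∑ i, inner ℂ (H.eigenvectorBasis i)
      (Matrix.toEuclideanLin (M * A) (H.eigenvectorBasis i)) := by
    rw [← LinearMap.trace_eq_sum_inner, Matrix.toEuclideanLin, Matrix.toLpLin_eq_toLin, Matrix.trace_toLin_eq]
  rw [htr, traceNorm]
  refine (norm_sum_le _ _).trans (Finset.sum_le_sum fun i _ => ?_)
  refine (norm_inner_le_norm _ _).trans ?_
  rw [H.eigenvectorBasis.orthonormal.1 i, one_mul,
    ← norm_toEuclideanLin_eigenvectorBasis A i]
  have h5 : Matrix.toEuclideanLin (M * A) (H.eigenvectorBasis i) =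
      Matrix.toEuclideanCLM (n := n) (𝕜 := ℂ) M
        (Matrix.toEuclideanLin A (H.eigenvectorBasis i)) := by
    ext k
    exact (congrFun (Matrix.mulVec_mulVec (H.eigenvectorBasis i) M A) k).symm
  rw [h5]
  exact (ContinuousLinearMap.le_opNorm _ _).trans
    (mul_le_of_le_one_left (norm_nonneg _) hM')

theorem traceNorm_nonneg (A : Matrix n n ℂ) : 0 ≤ traceNorm A :=
  Finset.sum_nonneg fun _ _ => Real.sqrt_nonneg _

end TraceNorm

/-! ### One-qubit states -/

/-- The phase `e^{iθ}`. -/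
def phase (θ : ZMod 8) : ℂ := ZMod.stdAddChar θ

theorem phase_add (θ η : ZMod 8) : phase (θ + η) = phase θ * phase η :=
  AddChar.map_add_eq_mul _ _ _

theorem star_phase_mul_phase (θ : ZMod 8) : star (phase θ) * phase θ = 1 := by
  have h : ‖phase θ‖ = 1 := by
    rw [phase, ZMod.stdAddChar_apply]
    exact Circle.norm_coe _
  rw [Complex.star_def, mul_comm, Complex.mul_conj, Complex.normSq_eq_norm_sq, h]
  simp

theorem phase_four : phase 4 = -1 := by
  have h := ZMod.stdAddChar_coe (N := 8) 4
  rw [phase, show (4 : ZMod 8) = ((4 : ℤ) : ZMod 8) from rfl, h, ← Complex.exp_pi_mul_I]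
  congr 1
  push_cast
  ring

theorem phase_four_mul (k : ℕ) : phase (4 * (k : ZMod 8)) = (-1) ^ k := by
  induction k with
  | zero => simp [phase]
  | succ k ih => rw [Nat.cast_succ, mul_add, mul_one, phase_add, ih, phase_four, pow_succ]

theorem phase_piTimes (b : Fin 2) : phase (piTimes b) = (-1) ^ b.val := phase_four_mul _

theorem plusKet_zero (θ : ZMod 8) : plusKet θ 0 = 1 / (Real.sqrt 2 : ℂ) := rfl

theorem plusKet_one (θ : ZMod 8) : plusKet θ 1 = phase θ / (Real.sqrt 2 : ℂ) := by
  have h : phase θ = Complex.exp (Complex.I * ((θ.val : ℂ) * (Real.pi : ℂ) / 4)) := by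
    rw [phase, ZMod.stdAddChar_apply, ZMod.toCircle_apply]
    congr 1
    push_cast
    ring
  rw [h]
  rfl

theorem sqrt_two_mul_self : (Real.sqrt 2 : ℂ) * (Real.sqrt 2 : ℂ) = 2 := by
  exact_mod_cast Real.mul_self_sqrt (by norm_num : (0 : ℝ) ≤ 2)

theorem star_plusKet_zero_mul (θ η : ZMod 8) : star (plusKet θ 0) * plusKet η 0 = 1 / 2 := by
  rw [plusKet_zero, plusKet_zero, Complex.star_def, map_div₀, map_one, Complex.conj_ofReal,
    div_mul_div_comm, sqrt_two_mul_self, one_mul]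

theorem star_plusKet_one_mul (θ η : ZMod 8) :
    star (plusKet θ 1) * plusKet η 1 = star (phase θ) * phase η / 2 := by
  rw [plusKet_one, plusKet_one, Complex.star_def, map_div₀, Complex.conj_ofReal,
    div_mul_div_comm, sqrt_two_mul_self]

theorem sum_star_plusKet_mul_self (θ : ZMod 8) : ∑ k, star (plusKet θ k) * plusKet θ k = 1 := by
  rw [Fin.sum_univ_two, star_plusKet_zero_mul, star_plusKet_one_mul, star_phase_mul_phase]
  norm_num

theorem sum_star_plusKet_mul_of_ne (θ : ZMod 8) {b c : Fin 2} (h : b ≠ c) :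
    ∑ k, star (plusKet (θ + piTimes b) k) * plusKet (θ + piTimes c) k = 0 := by
  rw [Fin.sum_univ_two, star_plusKet_zero_mul, star_plusKet_one_mul, phase_add, phase_add,
    star_mul, phase_piTimes, phase_piTimes]
  have h1 := star_phase_mul_phase θ
  rw [show star ((-1 : ℂ) ^ b.val) * star (phase θ) * (phase θ * (-1) ^ c.val)
    = star ((-1 : ℂ) ^ b.val) * (star (phase θ) * phase θ) * (-1) ^ c.val by ring, h1]
  fin_cases b <;> fin_cases c <;> simp at h ⊢ <;> norm_num

theorem sum_star_basisKet_mul_self (d : Fin 2) :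
    ∑ k, star (basisKet d k) * basisKet d k = 1 := by
  fin_cases d <;> simp [basisKet]

/-- The coordinate `z` lives on the diagonal and `x`, `y` off it. Hence basis states are flipped,
while equatorial states, whose diagonal is constant, are fixed. -/
theorem reflectXY_eq (A : Matrix (Fin 2) (Fin 2) ℂ) :
    reflectXY A = !![A 1 1, A 0 1; A 1 0, A 0 0] := by
  have hI := Complex.I_mul_I
  obtain ⟨a, b, c, d, rfl⟩ : ∃ a b c d, A = !![a, b; c, d] := ⟨_, _, _, _, Matrix.eta_fin_two A⟩
  ext i j
  fin_cases i <;> fin_cases j <;>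
    simp [reflectXY, pauliX, pauliY, pauliZ, Matrix.trace_fin_two] <;> grind

theorem reflectXY_proj_basisKet (d : Fin 2) :
    reflectXY (proj (basisKet d)) = proj (basisKet (d + 1)) := by
  rw [reflectXY_eq]
  ext i j
  fin_cases d <;> fin_cases i <;> fin_cases j <;>
    simp [proj, basisKet, Matrix.vecMulVec_apply]

theorem reflectXY_proj_plusKet (θ : ZMod 8) :
    reflectXY (proj (plusKet θ)) = proj (plusKet θ) := by
  have h0 := star_plusKet_zero_mul θ θ
  have h1 := star_plusKet_one_mul θ θ
  rw [star_phase_mul_phase] at h1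
  rw [reflectXY_eq]
  ext i j
  fin_cases i <;> fin_cases j <;> simp [proj, Matrix.vecMulVec_apply] <;>
    simp only [Complex.star_def] at h0 h1 <;> grind

/-! ### Product states -/

section Product

variable {V : Type} [Fintype V]

/-- The tensor product of one-qubit kets. -/
def productKet (φ : V → Fin 2 → ℂ) (x : V → Fin 2) : ℂ := ∏ v, φ v (x v)

theorem tensor_proj (φ : V → Fin 2 → ℂ) :
    (tensor fun v => proj (φ v)) = Matrix.vecMulVec (productKet φ) (star (productKet φ)) := by
  ext x y
  simp [tensor, proj, Matrix.vecMulVec_apply, productKet, Finset.prod_mul_distrib]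

theorem sum_star_productKet_mul [DecidableEq V] (φ ψ : V → Fin 2 → ℂ) :
    ∑ x, star (productKet φ x) * productKet ψ x = ∏ v, ∑ k, star (φ v k) * ψ v k := by
  rw [Fintype.prod_sum]
  refine Finset.sum_congr rfl fun x _ => ?_
  simp [productKet, Finset.prod_mul_distrib]

end Product

/-! ### The entangling operation -/

section Entangle

variable {V : Type} [Fintype V]

open Classical in
/-- The sign which the controlled-`Z` gates over the edges of a graph attach to a computational
basis state. -/
def edgeSign (G : SimpleGraph V) (x : V → Fin 2) : ℂ :=
  ∏ e ∈ G.edgeFinset, if ∀ v ∈ e, x v = 1 then (-1 : ℂ) else 1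

theorem edgeSign_mul_star (G : SimpleGraph V) (x : V → Fin 2) :
    star (edgeSign G x) * edgeSign G x = 1 := by
  classical
  rw [edgeSign, star_prod, ← Finset.prod_mul_distrib]
  refine Finset.prod_eq_one fun e _ => ?_
  split_ifs <;> simp

/-- Only the edges at `t` feel the change: they contribute nothing when `t` is `0`, and one sign per
neighbour in state `1` when `t` is `1`. This is the `Z` that such neighbours induce on `t`. -/
theorem edgeSign_update_one [DecidableEq V] (G : SimpleGraph V) (t : V) (x : V → Fin 2) :
    edgeSign G (Function.update x t 1) =
      edgeSign G (Function.update x t 0) * (-1) ^ {u | G.Adj t u ∧ x u = 1}.ncard := by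
  classical
  have hpow : ((-1 : ℂ)) ^ {u | G.Adj t u ∧ x u = 1}.ncard
      = ∏ u ∈ G.neighborFinset t, if x u = 1 then (-1 : ℂ) else 1 := by
    rw [Finset.prod_ite, Finset.prod_const, Finset.prod_const_one, mul_one,
      ← Set.ncard_coe_finset]
    congr 2
    ext u
    simp
  have hinc : ∏ u ∈ G.neighborFinset t, (if x u = 1 then (-1 : ℂ) else 1) =
      ∏ e ∈ G.edgeFinset with t ∈ e,
        if ∀ v ∈ e, Function.update x t 1 v = 1 then (-1 : ℂ) else 1 := by
    refine Finset.prod_bij (fun u _ => s(t, u)) ?_ ?_ ?_ ?_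
    · intro u hu
      simpa using hu
    · intro u _ v _ h
      exact Sym2.congr_right.1 h
    · intro e he
      rw [Finset.mem_filter, SimpleGraph.mem_edgeFinset] at he
      obtain ⟨u, rfl⟩ := Sym2.mem_iff_exists.1 he.2
      exact ⟨u, by simpa using he.1, rfl⟩
    · intro u hu
      have hne : u ≠ t := by
        rintro rfl
        simp at hu
      simp [hne]
  have hzero : ∏ e ∈ G.edgeFinset with t ∈ e,
      (if ∀ v ∈ e, Function.update x t 0 v = 1 then (-1 : ℂ) else 1) = 1 := by
    refine Finset.prod_eq_one fun e he => if_neg fun h => ?_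
    simpa using h t (Finset.mem_filter.1 he).2
  have hout : ∏ e ∈ G.edgeFinset with ¬ t ∈ e,
      (if ∀ v ∈ e, Function.update x t 0 v = 1 then (-1 : ℂ) else 1) =
      ∏ e ∈ G.edgeFinset with ¬ t ∈ e,
        (if ∀ v ∈ e, Function.update x t 1 v = 1 then (-1 : ℂ) else 1) := by
    refine Finset.prod_congr rfl fun e he => ?_
    have hv : ∀ v ∈ e, ∀ c : Fin 2, Function.update x t c v = x v := by
      intro v hv c
      refine Function.update_of_ne ?_ _ _
      rintro rfl
      exact (Finset.mem_filter.1 he).2 hv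
    congr 1
    refine propext (forall₂_congr fun v hve => ?_)
    rw [hv v hve, hv v hve]
  have hsplit : ∀ c : Fin 2, edgeSign G (Function.update x t c) =
      (∏ e ∈ G.edgeFinset with t ∈ e,
        if ∀ v ∈ e, Function.update x t c v = 1 then (-1 : ℂ) else 1) *
      ∏ e ∈ G.edgeFinset with ¬ t ∈ e,
        if ∀ v ∈ e, Function.update x t c v = 1 then (-1 : ℂ) else 1 := by
    intro c
    rw [Finset.prod_filter_mul_prod_filter_not, edgeSign]
    exact Finset.prod_congr rfl fun e _ => by congr
  rw [hsplit, hsplit, hzero, hout, hpow, hinc, one_mul, mul_comm]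

end Entangle

variable {N : ℕ}

/-! ### The adaptive measurement is complete -/

theorem place_injective (C : Computation N) (σ : Layout N) : Function.Injective (place C σ) := by
  have h : Function.Injective (graphHom C σ) := fun i j hij =>
    (Prod.ext_iff.1 (σ.symm.injective hij)).2
  exact h.sumMap (SimpleGraph.Hom.mapEdgeSet.injective _ h)

theorem baseAngle_place (C : Computation N) (ν : Secret N) (b : Qubit N → Fin 2)
    (c : DottedVertex C.graph) :
    baseAngle C ν b (place C ν.layout c) =
      adaptedAngle C (fun c => b (place C ν.layout c) + ν.r (place C ν.layout c)) c := by
  classical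
  exact (place_injective C ν.layout).extend_apply _ _ _

open Classical in
theorem baseAngle_of_not_isComputation (C : Computation N) (ν : Secret N) (b : Qubit N → Fin 2)
    {w : Qubit N} (hw : ¬ IsComputation C ν.layout w) :
    baseAngle C ν b w = if IsTrap ν.layout w then piTimes (ν.a w) else 0 :=
  Function.extend_apply' _ _ _ hw

theorem adaptedAngle_congr (C : Computation N) {s s' : DottedVertex C.graph → Fin 2}
    {i : DottedVertex C.graph} (h : ∀ j, C.step j < C.step i → s j = s' j) :
    adaptedAngle C s i = adaptedAngle C s' i := by
  rw [adaptedAngle, adaptedAngle, C.xCorr_causal i s s' h, C.zCorr_causal i s s' h]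

/-- Outside the computation the angles ignore the outcomes, so any difference there will do.
Otherwise an earliest differing computation qubit works: its corrections see only strictly earlier
outcomes, where the two strings agree. -/
theorem exists_measAngle_eq_of_ne (C : Computation N) (ν : Secret N) {b b' : Qubit N → Fin 2}
    (h : b ≠ b') : ∃ w, measAngle C ν b w = measAngle C ν b' w ∧ b w ≠ b' w := by
  suffices H : ∃ w, baseAngle C ν b w = baseAngle C ν b' w ∧ b w ≠ b' w by
    obtain ⟨w, hw, hne⟩ := H
    exact ⟨w, by rw [measAngle, measAngle, hw], hne⟩
  by_cases hout : ∃ w, ¬ IsComputation C ν.layout w ∧ b w ≠ b' w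
  · obtain ⟨w, hw, hne⟩ := hout
    exact ⟨w, by rw [baseAngle_of_not_isComputation C ν b hw,
      baseAngle_of_not_isComputation C ν b' hw], hne⟩
  push Not at hout
  obtain ⟨w, hw⟩ := Function.ne_iff.1 h
  obtain ⟨c, rfl⟩ : IsComputation C ν.layout w := by
    by_contra hc
    exact hw (hout w hc)
  set S : Set (DottedVertex C.graph) :=
    {c | b (place C ν.layout c) ≠ b' (place C ν.layout c)} with hS
  have hne : S.Nonempty := ⟨c, hw⟩
  refine ⟨place C ν.layout (Function.argminOn C.step S hne), ?_,
    Function.argminOn_mem C.step S hne⟩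
  rw [baseAngle_place, baseAngle_place]
  refine adaptedAngle_congr C fun j hj => ?_
  have hj' : j ∉ S := fun hmem => Function.not_lt_argminOn C.step S hmem hj
  rw [not_not.1 hj']

/-- The kets onto which the prover projects when the outcomes `b` are reported. -/
def measKet (C : Computation N) (ν : Secret N) (b : Qubit N → Fin 2) (w : Qubit N) : Fin 2 → ℂ :=
  plusKet (measAngle C ν b w + piTimes (b w))

/-- The overlap factorises over qubits. At a qubit measured at the same angle with different
outcomes the factor is `⟨+_δ|-_δ⟩ = 0`. -/
theorem sum_star_productKet_measKet_mul (C : Computation N) (ν : Secret N)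
    (b b' : Qubit N → Fin 2) :
    ∑ x, star (productKet (measKet C ν b) x) * productKet (measKet C ν b') x =
      if b = b' then 1 else 0 := by
  rw [sum_star_productKet_mul]
  split_ifs with h
  · subst h
    exact Finset.prod_eq_one fun w _ => sum_star_plusKet_mul_self _
  · obtain ⟨w, hw, hne⟩ := exists_measAngle_eq_of_ne C ν h
    refine Finset.prod_eq_zero (Finset.mem_univ w) ?_
    rw [measKet, measKet, hw]
    exact sum_star_plusKet_mul_of_ne _ hne

/-- The graph along whose edges the prover entangles the qubits. -/
abbrev resourceGraph (N : ℕ) : SimpleGraph (Qubit N) := dotted (⊤ : SimpleGraph (Fin (3 * N)))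

/-- The unitary that takes the input state to the amplitudes of the outcomes. -/
def outcomeUnitary (C : Computation N) (ν : Secret N) : Op (Qubit N) :=
  Matrix.of fun b x => star (productKet (measKet C ν b) x) * edgeSign (resourceGraph N) x

theorem outcomeUnitary_mul_conjTranspose (C : Computation N) (ν : Secret N) :
    outcomeUnitary C ν * (outcomeUnitary C ν).conjTranspose = 1 := by
  ext b b'
  rw [Matrix.mul_apply, Matrix.one_apply, ← sum_star_productKet_measKet_mul C ν b b']
  refine Finset.sum_congr rfl fun x _ => ?_
  have h := edgeSign_mul_star (resourceGraph N) x
  rw [Matrix.conjTranspose_apply, outcomeUnitary, Matrix.of_apply, Matrix.of_apply, star_mul,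
    star_star]
  linear_combination (star (productKet (measKet C ν b) x) * productKet (measKet C ν b') x) * h

theorem conjTranspose_mul_outcomeUnitary (C : Computation N) (ν : Secret N) :
    (outcomeUnitary C ν).conjTranspose * outcomeUnitary C ν = 1 :=
  -- There are as many outcome strings as basis states, so orthonormal rows already give
  -- completeness.
  mul_eq_one_comm.1 (outcomeUnitary_mul_conjTranspose C ν)

theorem outcomeUnitary_eq (C : Computation N) (ν : Secret N) :
    outcomeUnitary C ν =
      (Matrix.of fun b x => star (productKet (measKet C ν b) x)) * entangle (resourceGraph N) := by
  ext b x
  rw [entangle, Matrix.mul_diagonal]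
  rfl

/-! ### Outcome and rejection probabilities through the unitary. -/

theorem outcomeProb_eq (C : Computation N) (ν : Secret N) (ρ : Op (Qubit N))
    (b : Qubit N → Fin 2) :
    outcomeProb C ν ρ b =
      ((outcomeUnitary C ν * ρ * (outcomeUnitary C ν).conjTranspose) b b).re := by
  have h : ∀ (X : Op (Qubit N)) (v : (Qubit N → Fin 2) → ℂ) (K : Op (Qubit N)),
      (∀ x, K b x = star (v x)) →
      (Matrix.vecMulVec v (star v) * X).trace = (K * X * K.conjTranspose) b b := by
    intro X v K hK
    rw [Matrix.vecMulVec_mul, Matrix.trace_vecMulVec, Matrix.mul_apply, dotProduct]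
    refine Finset.sum_congr rfl fun x _ => ?_
    rw [Matrix.conjTranspose_apply, hK, star_star, mul_comm]
    congr 1
    rw [Matrix.vecMul, Matrix.mul_apply, dotProduct]
    exact Finset.sum_congr rfl fun y _ => by rw [hK]; rfl
  have hU := outcomeUnitary_eq C ν
  rw [outcomeProb, tensor_proj, hU, Matrix.conjTranspose_mul]
  simp only [← Matrix.mul_assoc]
  have := h (entangle (resourceGraph N) * ρ * (entangle (resourceGraph N)).conjTranspose)
    (productKet (measKet C ν b)) (Matrix.of fun b x => star (productKet (measKet C ν b) x))
    (fun _ => rfl)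
  simp only [← Matrix.mul_assoc] at this
  rw [← this]
  rfl

theorem sum_outcomeProb (C : Computation N) (ν : Secret N) (ρ : Op (Qubit N)) :
    ∑ b, outcomeProb C ν ρ b = ρ.trace.re := by
  simp only [outcomeProb_eq]
  rw [← Complex.re_sum]
  change (Matrix.trace (outcomeUnitary C ν * ρ * (outcomeUnitary C ν).conjTranspose)).re = _
  rw [Matrix.trace_mul_comm, ← Matrix.mul_assoc, conjTranspose_mul_outcomeUnitary, Matrix.one_mul]

theorem outcomeProb_nonneg (C : Computation N) (ν : Secret N) {ρ : Op (Qubit N)}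
    (hρ : ρ.PosSemidef) (b : Qubit N → Fin 2) : 0 ≤ outcomeProb C ν ρ b := by
  rw [outcomeProb_eq]
  exact (Complex.le_def.1 (hρ.mul_mul_conjTranspose_same (outcomeUnitary C ν)).diag_nonneg).1

theorem rejectProb_nonneg (C : Computation N) (ν : Secret N) {ρ : Op (Qubit N)}
    (hρ : ρ.PosSemidef) : 0 ≤ rejectProb C ν ρ := by
  refine Finset.sum_nonneg fun b _ => ?_
  split_ifs
  · exact le_rfl
  · exact outcomeProb_nonneg C ν hρ b

open Classical in
/-- The projection onto the outcomes that the verifier rejects, pulled back to the input. -/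
def rejectProjection (C : Computation N) (ν : Secret N) : Op (Qubit N) :=
  (outcomeUnitary C ν).conjTranspose *
    Matrix.diagonal (fun b => if Accepts ν b then (0 : ℂ) else 1) * outcomeUnitary C ν

theorem isStarProjection_rejectProjection (C : Computation N) (ν : Secret N) :
    IsStarProjection (rejectProjection C ν) := by
  classical
  set D : Op (Qubit N) := Matrix.diagonal (fun b => if Accepts ν b then (0 : ℂ) else 1) with hD
  set U := outcomeUnitary C ν with hU
  have hDD : D * D = D := by
    rw [hD, Matrix.diagonal_mul_diagonal]
    congr 1
    ext b
    split_ifs <;> simp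
  have hDs : D.conjTranspose = D := by
    rw [hD, Matrix.diagonal_conjTranspose]
    congr 1
    ext b
    rw [Pi.star_apply]
    split_ifs <;> simp
  have hR : rejectProjection C ν = U.conjTranspose * D * U := by
    rw [rejectProjection, hD]
  rw [hR]
  refine ⟨?_, ?_⟩
  · calc U.conjTranspose * D * U * (U.conjTranspose * D * U)
        = U.conjTranspose * D * (U * U.conjTranspose) * D * U := by
          simp only [Matrix.mul_assoc]
      _ = U.conjTranspose * D * U := by
          rw [hU, outcomeUnitary_mul_conjTranspose, Matrix.mul_one, Matrix.mul_assoc _ D D, hDD]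
  · rw [IsSelfAdjoint, Matrix.star_eq_conjTranspose, Matrix.conjTranspose_mul,
      Matrix.conjTranspose_mul, Matrix.conjTranspose_conjTranspose, hDs, Matrix.mul_assoc]

theorem rejectProb_eq (C : Computation N) (ν : Secret N) (ρ : Op (Qubit N)) :
    rejectProb C ν ρ = (rejectProjection C ν * ρ).trace.re := by
  classical
  rw [rejectProjection, Matrix.mul_assoc, Matrix.mul_assoc, Matrix.trace_mul_comm,
    Matrix.mul_assoc, Matrix.trace, Complex.re_sum, rejectProb]
  refine Finset.sum_congr rfl fun b _ => ?_
  rw [Matrix.diag_apply, Matrix.diagonal_mul, outcomeProb_eq]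
  split_ifs <;> simp

/-- The factor 2 is the price of using neither Hermiticity nor equal traces. -/
theorem rejectProb_sub_le (C : Computation N) (ν : Secret N) (ρ τ : Op (Qubit N)) :
    |rejectProb C ν ρ - rejectProb C ν τ| ≤ 2 * traceDist ρ τ := by
  rw [rejectProb_eq, rejectProb_eq, ← Complex.sub_re, ← Matrix.trace_sub, ← Matrix.mul_sub,
    traceDist, mul_div_cancel₀ _ two_ne_zero]
  exact (Complex.abs_re_le_norm _).trans
    (norm_trace_mul_le_traceNorm _ _ (isStarProjection_rejectProjection C ν))

/-! ### The reflected input -/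

theorem not_isComputation_of_isTrap (C : Computation N) {σ : Layout N} {t : Qubit N}
    (ht : IsTrap σ t) : ¬ IsComputation C σ t := by
  rintro ⟨c | ⟨e, he⟩, rfl⟩
  · simp [place, graphHom, IsTrap] at ht
  · induction e using Sym2.ind with
    | _ i j =>
      have := ht (graphHom C σ i) (Sym2.mem_iff.2 (Or.inl rfl))
      simp [graphHom] at this

/-- Adjacent qubits are a dotted vertex and an endpoint of its edge. Dotted computation and trap
qubits have both endpoints in group `0`, respectively `2`, so neither touches group `1`. The
endpoints of a dotted trap lie in group `2`, which has no primary computation or trap qubits. -/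
theorem isDummy_of_adj_isTrap (C : Computation N) {σ : Layout N} {t u : Qubit N}
    (ht : IsTrap σ t) (h : (resourceGraph N).Adj t u) : IsDummy C σ u := by
  rcases t with v | e <;> rcases u with w | f
  · exact h.elim
  · refine ⟨?_, fun hf => ?_⟩
    · rintro ⟨c | ⟨f', hf'⟩, hc⟩
      · cases hc
      · obtain rfl := Sum.inr_injective hc
        obtain ⟨i, -, hi⟩ := Sym2.mem_map.1 (show v ∈ Sym2.map (graphHom C σ) f' from h)
        rw [← hi] at ht
        simp [graphHom, IsTrap] at ht
    · have h1 : (σ v).1 = 1 := ht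
      have h2 : (σ v).1 = 2 := hf v h
      rw [h1] at h2
      exact absurd h2 (by decide)
  · have h2 : (σ w).1 = 2 := ht w h
    refine ⟨?_, fun hw => ?_⟩
    · rintro ⟨c | c, hc⟩
      · obtain rfl := Sum.inl_injective hc
        simp [graphHom] at h2
      · cases hc
    · have h1 : (σ w).1 = 1 := hw
      rw [h1] at h2
      exact absurd h2 (by decide)
  · exact h.elim

open Classical in
/-- The kets of the reflected input: the dummies are flipped. -/
def flippedKet (C : Computation N) (ν : Secret N) (w : Qubit N) : Fin 2 → ℂ :=
  if IsDummy C ν.layout w then basisKet (ν.d w + 1) else plusKet (ν.θ w)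

theorem reflectedInput_eq (C : Computation N) (ν : Secret N) :
    reflectedInput C ν = Matrix.vecMulVec (productKet (flippedKet C ν))
      (star (productKet (flippedKet C ν))) := by
  rw [← tensor_proj, reflectedInput]
  congr 1
  ext1 w
  rw [idealKet, flippedKet]
  split_ifs
  · exact reflectXY_proj_basisKet _
  · exact reflectXY_proj_plusKet _

theorem trace_reflectedInput (C : Computation N) (ν : Secret N) :
    (reflectedInput C ν).trace = 1 := by
  rw [reflectedInput_eq, Matrix.trace_vecMulVec, dotProduct_comm]
  refine (sum_star_productKet_mul _ _).trans (Finset.prod_eq_one fun w _ => ?_)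
  rw [flippedKet]
  split_ifs
  · exact sum_star_basisKet_mul_self _
  · exact sum_star_plusKet_mul_self _

/-- The amplitude of the outcomes `b` on the reflected input, before summing over the computational
basis. -/
def amplitudeTerm (C : Computation N) (ν : Secret N) (b x : Qubit N → Fin 2) : ℂ :=
  outcomeUnitary C ν b x * productKet (flippedKet C ν) x

theorem amplitudeTerm_eq_zero (C : Computation N) (ν : Secret N) (b : Qubit N → Fin 2)
    {x : Qubit N → Fin 2} {u : Qubit N} (hu : IsDummy C ν.layout u) (h : x u ≠ ν.d u + 1) :
    amplitudeTerm C ν b x = 0 := by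
  rw [amplitudeTerm, productKet, Finset.prod_eq_zero (Finset.mem_univ u), mul_zero]
  rw [flippedKet, if_pos hu, basisKet, Pi.single_eq_of_ne h]

/-- After the flip, the neighbours of `t` in state `1` are exactly the dummies meant to be `0`, so
expected and actual `Z`s add up to all dummy neighbours. -/
theorem ncard_dummyNeighbors_eq (C : Computation N) (ν : Secret N) (t : Qubit N)
    {x : Qubit N → Fin 2} (hx : ∀ u, IsDummy C ν.layout u → x u = ν.d u + 1)
    (ht : IsTrap ν.layout t) :
    (dummyNeighbors C ν.layout t).ncard =
      oneNeighbors C ν t + {u | (resourceGraph N).Adj t u ∧ x u = 1}.ncard := by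
  have hset : {u | (resourceGraph N).Adj t u ∧ x u = 1} =
      dummyNeighbors C ν.layout t \ {u ∈ dummyNeighbors C ν.layout t | ν.d u = 1} := by
    ext u
    have h2 : ∀ d : Fin 2, d + 1 = 1 ↔ ¬ d = 1 := by decide
    constructor
    · rintro ⟨hadj, hu⟩
      have hd := isDummy_of_adj_isTrap C ht hadj
      rw [hx u hd, h2] at hu
      exact ⟨⟨hadj, hd⟩, fun h => hu h.2⟩
    · rintro ⟨hu, hu'⟩
      refine ⟨hu.1, ?_⟩
      rw [hx u hu.2, h2]
      exact fun h => hu' ⟨hu, h⟩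
  rw [hset, oneNeighbors, add_comm]
  exact (Set.ncard_sdiff_add_ncard_of_subset (Set.sep_subset _ _) (Set.toFinite _)).symm

theorem amplitudeTerm_update (C : Computation N) (ν : Secret N) {b : Qubit N → Fin 2}
    (hb : Accepts ν b) {t : Qubit N} (ht : IsTrap ν.layout t)
    (hodd : Odd (dummyNeighbors C ν.layout t).ncard) (x : Qubit N → Fin 2) :
    amplitudeTerm C ν b (Function.update x t 0) + amplitudeTerm C ν b (Function.update x t 1) =
      0 := by
  have htd : ¬ IsDummy C ν.layout t := fun h => h.2 ht
  -- A basis state that disagrees with some flipped dummy has zero amplitude, both before and after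
  -- changing `t`.
  by_cases hx : ∀ u, IsDummy C ν.layout u → x u = ν.d u + 1
  swap
  · push Not at hx
    obtain ⟨u, hu, hne⟩ := hx
    have hut : u ≠ t := by
      rintro rfl
      exact htd hu
    rw [amplitudeTerm_eq_zero C ν b hu (by rwa [Function.update_of_ne hut]),
      amplitudeTerm_eq_zero C ν b hu (by rwa [Function.update_of_ne hut]), add_zero]
  have hcard := ncard_dummyNeighbors_eq C ν t hx ht
  set k := {u | (resourceGraph N).Adj t u ∧ x u = 1}.ncard with hk
  have hsplit : ∀ c : Fin 2, amplitudeTerm C ν b (Function.update x t c) =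
      star (measKet C ν b t c) * flippedKet C ν t c *
        edgeSign (resourceGraph N) (Function.update x t c) *
        ∏ w ∈ Finset.univ.erase t, star (measKet C ν b w (x w)) * flippedKet C ν w (x w) := by
    intro c
    have hprod : ∏ w, star (measKet C ν b w (Function.update x t c w)) *
          flippedKet C ν w (Function.update x t c w) =
        star (measKet C ν b t c) * flippedKet C ν t c *
          ∏ w ∈ Finset.univ.erase t, star (measKet C ν b w (x w)) * flippedKet C ν w (x w) := by
      rw [← Finset.mul_prod_erase _ _ (Finset.mem_univ t), Function.update_self]
      congr 1
      refine Finset.prod_congr rfl fun w hw => ?_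
      rw [Function.update_of_ne (Finset.ne_of_mem_erase hw)]
    rw [mul_right_comm, ← hprod, Finset.prod_mul_distrib, ← star_prod]
    simp only [amplitudeTerm, outcomeUnitary, Matrix.of_apply, productKet]
    ring
  -- The rotation `θ` cancels, leaving the sign of the expected `Z`s times that of the actual ones,
  -- i.e. `-1` to the odd number of dummy neighbours.
  have hphase : star (phase (measAngle C ν b t + piTimes (b t))) * phase (ν.θ t) * (-1) ^ k
      = -1 := by
    have hangle : measAngle C ν b t + piTimes (b t) =
        ν.θ t + (4 * (oneNeighbors C ν t : ZMod 8)
          + (piTimes (ν.a t) + piTimes (ν.r t) + piTimes (ν.r t + ν.a t))) := by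
      rw [measAngle, baseAngle_of_not_isComputation C ν b (not_isComputation_of_isTrap C ht),
        if_pos ht, hb t ht]
      ring
    -- Acceptance enters here: the expected outcome `r + a` undoes the shifts by `aπ` and `rπ`.
    have hbits : ∀ a r : Fin 2, piTimes a + piTimes r + piTimes (r + a) = 0 := by decide
    rw [hangle, hbits, add_zero, phase_add, phase_four_mul, star_mul, star_pow, star_neg, star_one,
      mul_assoc _ (star (phase (ν.θ t))), star_phase_mul_phase, mul_one, ← pow_add, ← hcard]
    exact hodd.neg_one_pow
  have hflip : flippedKet C ν t = plusKet (ν.θ t) := by rw [flippedKet, if_neg htd]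
  rw [hsplit, hsplit, hflip, measKet, star_plusKet_zero_mul, star_plusKet_one_mul,
    edgeSign_update_one]
  linear_combination
    (edgeSign (resourceGraph N) (Function.update x t 0) / 2 *
    ∏ w ∈ Finset.univ.erase t, star (measKet C ν b w (x w)) * flippedKet C ν w (x w)) * hphase

theorem outcomeProb_reflectedInput_eq_zero (C : Computation N) (ν : Secret N)
    (hodd : HasOddTrap C ν.layout) {b : Qubit N → Fin 2} (hb : Accepts ν b) :
    outcomeProb C ν (reflectedInput C ν) b = 0 := by
  obtain ⟨t, ht, hodd⟩ := hodd
  have hsum : (outcomeUnitary C ν).mulVec (productKet (flippedKet C ν)) b = 0 := by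
    have hpair : ∀ x : Qubit N → Fin 2, amplitudeTerm C ν b x +
        amplitudeTerm C ν b (Function.update x t (x t + 1)) = 0 := by
      intro x
      have h := amplitudeTerm_update C ν hb ht hodd x
      have h2 : x t = 0 ∨ x t = 1 := by
        generalize x t = c
        fin_cases c <;> simp
      rcases h2 with h2 | h2
      · have hx : Function.update x t 0 = x := by rw [← h2, Function.update_eq_self]
        have hc : x t + 1 = 1 := by rw [h2, zero_add]
        rwa [hx, ← hc] at h
      · have hx : Function.update x t 1 = x := by rw [← h2, Function.update_eq_self]
        have hc : x t + 1 = 0 := by rw [h2]; rfl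
        rwa [hx, add_comm, ← hc] at h
    -- Flipping the bit at `t` is a fixed-point-free involution that pairs opposite terms.
    refine Finset.sum_involution (fun x _ => Function.update x t (x t + 1)) (fun x _ => hpair x)
      (fun x _ _ h => ?_) (fun _ _ => Finset.mem_univ _) (fun x _ => ?_)
    · have h1 := congrFun h t
      rw [Function.update_self] at h1
      simp at h1
    · have h2 : ∀ c : Fin 2, c + 1 + 1 = c := by decide
      rw [Function.update_idem, Function.update_self, h2, Function.update_eq_self]
  rw [outcomeProb_eq, reflectedInput_eq, Matrix.mul_vecMulVec, Matrix.vecMulVec_mul,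
    Matrix.vecMulVec_apply, hsum, zero_mul, Complex.zero_re]

theorem rejectProb_reflectedInput (C : Computation N) (ν : Secret N)
    (hodd : HasOddTrap C ν.layout) : rejectProb C ν (reflectedInput C ν) = 1 := by
  have h : rejectProb C ν (reflectedInput C ν) = ∑ b, outcomeProb C ν (reflectedInput C ν) b := by
    refine Finset.sum_congr rfl fun b _ => ?_
    split_ifs with hb
    · exact (outcomeProb_reflectedInput_eq_zero C ν hodd hb).symm
    · rfl
  rw [h, sum_outcomeProb, trace_reflectedInput, Complex.one_re]

/-! ### Robustness and averaging over the secrets. -/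

theorem one_sub_sqrt_le_rejectProb (C : Computation N) (ν : Secret N)
    (hodd : HasOddTrap C ν.layout) {ρ : Op (Qubit N)} (hρ : ρ.PosSemidef) {ε : ℝ}
    (hε : traceDist ρ (reflectedInput C ν) ≤ ε) :
    1 - 2 * Real.sqrt ε ≤ rejectProb C ν ρ := by
  have hε0 : 0 ≤ ε := (div_nonneg (traceNorm_nonneg _) zero_le_two).trans hε
  -- For `ε ≥ 1` the lower bound is negative and positivity of `ρ` suffices; for `ε ≤ 1` the linear
  -- bound `1 - 2ε` is enough, since `ε ≤ √ε`.
  rcases le_total 1 ε with h1 | h1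
  · have := Real.one_le_sqrt.2 h1
    linarith [rejectProb_nonneg C ν hρ]
  · have hs : ε ≤ Real.sqrt ε := Real.le_sqrt_of_sq_le (by nlinarith)
    have := (abs_le.1 (rejectProb_sub_le C ν ρ (reflectedInput C ν))).1
    rw [rejectProb_reflectedInput C ν hodd] at this
    linarith

/-- Needed to divide by the number of secrets in the average. -/
instance (N : ℕ) : Nonempty (Secret N) :=
  ⟨⟨finProdFinEquiv.symm, 0, 0, 0, 0⟩⟩

end FK

end

theorem lemmal :
    ∃ K : ℝ, 0 < K ∧ ∀ (N : ℕ) (C : FK.Computation N),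
      (∀ σ : FK.Layout N, FK.HasOddTrap C σ) →
      (∀ ν : FK.Secret N, FK.rejectProb C ν (FK.reflectedInput C ν) = 1) ∧
      ∀ (ε : ℝ) (ρ : FK.Secret N → FK.Op (FK.Qubit N)),
        (∀ ν, FK.IsDensity (ρ ν)) →
        (∀ ν, FK.traceDist (ρ ν) (FK.reflectedInput C ν) ≤ ε) →
        (∀ ν, 1 - K * Real.sqrt ε ≤ FK.rejectProb C ν (ρ ν)) ∧
        1 - K * Real.sqrt ε ≤ FK.protocolRejectProb C ρ := by
  refine ⟨2, two_pos, fun N C hodd =>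
    ⟨fun ν => FK.rejectProb_reflectedInput C ν (hodd _), fun ε ρ hρ hε => ?_⟩⟩
  have h : ∀ ν, 1 - 2 * Real.sqrt ε ≤ FK.rejectProb C ν (ρ ν) := fun ν =>
    FK.one_sub_sqrt_le_rejectProb C ν (hodd _) (hρ ν).1 (hε ν)
  refine ⟨h, ?_⟩
  rw [FK.protocolRejectProb, le_div_iff₀ (by exact_mod_cast Fintype.card_pos)]
  calc (1 - 2 * Real.sqrt ε) * (Fintype.card (FK.Secret N) : ℝ)
      = ∑ _ν : FK.Secret N, (1 - 2 * Real.sqrt ε) := by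
        rw [Finset.sum_const, Finset.card_univ, nsmul_eq_mul, mul_comm]
    _ ≤ _ := Finset.sum_le_sum fun ν _ => h ν
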